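/- Let $A$ be a commutative local ring with maximal ideal $\mathfrak M$ (constructively: $\mathfrak M$ is detachable). Let $f_1,\dots,f_n\in A[X_1,\dots,X_n]$ be a system with a residually simple zero at the origin, i.e. $f_i(0,\dots,0)\in\mathfrak M$ for all $i$ and the Jacobian determinant $\det(\partial f_j/\partial X_i)_{i,j}$ takes at $(0,\dots,0)$ a value in $A^\times$. Put $$B=A[X_1,\dots,X_n]/\langle f_1,\dots,f_n\rangle=A[x_1,\dots,x_n],\qquad \mathfrak M_B=\mathfrak M B+\langle x_1,\dots,x_n\rangle B,$$ and let $B_{1+\mathfrak M_B}$ be the localization of $B$ at the multiplicative set $1+\mathfrak M_B$. For $f\in A[X]$, let $A[x]=A[X]/\langle f\rangle$, with $x$ the class of $X$, and let $A_{\langle f\rangle}$ be the localization of $A[x]$ at $1+\mathfrak M+xA[x]$. Then $B_{1+\mathfrak M_B}$ is a local ring, and there exist an element $y\in\mathfrak M_B$ and a monic polynomial $f\in A[X]$ with $f(y)=0$ in $B$, $f(0)\in\mathfrak M$ and $f'(0)\in 1+\mathfrak M$ (so that $f'(0)$ is a unit and $f'(y)\in 1+\mathfrak M_B$), such that: 1.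 each $x_i$, viewed in $B_{1+\mathfrak M_B}$, belongs to $A[y]_{1+\mathfrak M+yA[y]}$, i.e. equals $p/q$ for some $p\in A[y]$ and $q\in 1+\mathfrak M+yA[y]$, where $A[y]\subseteq B$ is the $A$-subalgebra generated by $y$; 2. the natural $A$-algebra morphism $A_{\langle f\rangle}\to B_{1+\mathfrak M_B}$ sending $x$ to $y$ is an isomorphism. -/

import Mathlib

namespace Hensel

/-- The Jacobian `J_f` of a system of `n` polynomials in `n` variables: the determinant of the
Jacobian matrix `(∂ f_j / ∂ X_i)`. -/
noncomputable def jacobian {A : Type*} [CommRing A] {n : ℕ}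
    (f : Fin n → MvPolynomial (Fin n) A) : MvPolynomial (Fin n) A :=
  Matrix.det (Matrix.of fun i j => MvPolynomial.pderiv i (f j))

/-- A system with a residually simple zero at the origin: the values `f_i(0)` lie in the maximal
ideal of `A`, and the Jacobian of the system takes a unit value at the origin. -/
structure IsHenselSystem {A : Type*} [CommRing A] [IsLocalRing A] {n : ℕ}
    (f : Fin n → MvPolynomial (Fin n) A) : Prop where
  eval_mem : ∀ i, MvPolynomial.eval 0 (f i) ∈ IsLocalRing.maximalIdeal A
  isUnit_jacobian : IsUnit (MvPolynomial.eval 0 (jacobian f))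

/-- The multiplicative set `1 + I` of an ideal `I`. -/
def onePlus {R : Type*} [CommRing R] (I : Ideal R) : Submonoid R where
  carrier := {r | r - 1 ∈ I}
  one_mem' := by simp
  mul_mem' {a b} ha hb := by
    have h : a * b - 1 = a * (b - 1) + (a - 1) := by ring
    simpa only [Set.mem_ofPred_eq, h] using I.add_mem (I.mul_mem_left a hb) ha

/-- The ideal `M R + ⟨t : t ∈ T⟩ R` of an algebra `R` over the local ring `A` with maximal
ideal `M`. -/
def originIdeal (A : Type*) [CommRing A] [IsLocalRing A] {R : Type*} [CommRing R] [Algebra A R]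
    (T : Set R) : Ideal R :=
  (IsLocalRing.maximalIdeal A).map (algebraMap A R) ⊔ Ideal.span T

/-- The quotient ring `B = A[X_1, …, X_n] / ⟨f_1, …, f_n⟩ = A[x_1, …, x_n]`. -/
abbrev QuotientRing {A : Type*} [CommRing A] {n : ℕ} (f : Fin n → MvPolynomial (Fin n) A) :
    Type _ :=
  MvPolynomial (Fin n) A ⧸ Ideal.span (Set.range f)

/-- The generator `x_i` of `B`, the class of the variable `X_i`. -/
noncomputable def coord {A : Type*} [CommRing A] {n : ℕ} (f : Fin n → MvPolynomial (Fin n) A)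
    (i : Fin n) : QuotientRing f :=
  Ideal.Quotient.mk (Ideal.span (Set.range f)) (MvPolynomial.X i)

/-- The ideal `M_B = M B + ⟨x_1, …, x_n⟩ B` of `B`. -/
noncomputable def maxIdeal {A : Type*} [CommRing A] [IsLocalRing A] {n : ℕ}
    (f : Fin n → MvPolynomial (Fin n) A) : Ideal (QuotientRing f) :=
  originIdeal A (Set.range (coord f))

/-- The ring `A_⟨f_1, …, f_n⟩ = B_{1 + M_B}`. -/
abbrev LocalAlgebra {A : Type*} [CommRing A] [IsLocalRing A] {n : ℕ}
    (f : Fin n → MvPolynomial (Fin n) A) : Type _ :=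
  Localization (onePlus (maxIdeal f))

/-- The ring `A_⟨f⟩` for one polynomial `f` in one variable: with `A[x] = A[X] / ⟨f⟩`, it is
the localization of `A[x]` at `1 + M + x A[x]`. -/
abbrev LocalAlgebraOne {A : Type*} [CommRing A] [IsLocalRing A] (f : Polynomial A) : Type _ :=
  Localization (onePlus (originIdeal A {AdjoinRoot.root f}))

/-- For `y ∈ B` and `z ∈ B_{1 + M_B}`: `z` lies in `A[y]_{1 + M + y A[y]}`, that is, `z = p / q`
in `B_{1 + M_B}` for some `p ∈ A[y]` and `q ∈ 1 + M + y A[y]`, where `A[y]` is the `A`-subalgebra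
of `B` generated by `y`. When `y ∈ M_B`, such a `q` lies in `1 + M_B` and so is invertible in
`B_{1 + M_B}`. -/
def MemAdjoinLocalized {A : Type*} [CommRing A] [IsLocalRing A] {n : ℕ}
    (f : Fin n → MvPolynomial (Fin n) A) (y : QuotientRing f) (z : LocalAlgebra f) : Prop :=
  ∃ p q : Algebra.adjoin A {y},
    q ∈ onePlus (originIdeal A {(⟨y, Algebra.self_mem_adjoin_singleton A y⟩ :
      Algebra.adjoin A {y})}) ∧
    z * algebraMap (QuotientRing f) (LocalAlgebra f) q =
      algebraMap (QuotientRing f) (LocalAlgebra f) p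

end Hensel

/-! Write `M` for the maximal ideal of `A` and `M_B` for `maxIdeal F`. The Jacobian is a unit at the
origin, so linearizing the equations there gives `M_B ⊆ M B + M_B²`, and Nakayama yields `t ∈ 1 +
M_B` with `t M_B ⊆ M B` (`exists_onePlus_mul_mem_map`). Hence `B` is quasi-finite at `M_B`, and
Zariski's main theorem produces `r ∈ 1 + M_B` with `r` and all `r x_i` integral
(`exists_onePlus_isIntegral`). The algebra `C = A[r, r x_1, …, r x_n]` is then finite over `A` and
equals `B` once `r` is inverted.

Some `e ∈ C ∩ (1 + M_B)` satisfies `e C ⊆ A e + M C`; modulo `M` it is an idempotent cutting out the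
origin. Put `y = 1 - e`. Nakayama over `A[y]` gives `q ∈ 1 + M + y A[y]` with `q C ⊆ A[y]`, so each
`x_i = q r x_i / (q r)` is a fraction in `y`. The relation `q (1 - y) y ∈ M A[y]` is an equation for
`y` with a residually simple zero at `0` (`exists_adjoin_generator`), which integrality of `y` makes
monic.

The morphism `x ↦ y` is surjective because the `x_i` are fractions in `y` (`exists_algEquiv`). A
Newton correction shows that its kernel is finitely generated and idempotent, hence zero
(`injective_of_surjective`). -/

namespace Hensel

/-! ### Localization at `1 + I` for a maximal ideal `I` -/

section OnePlus

variable {R : Type*} [CommRing R]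

lemma mem_onePlus {I : Ideal R} {r : R} : r ∈ onePlus I ↔ r - 1 ∈ I := Iff.rfl

lemma notMem_of_mem_onePlus {I : Ideal R} (hI : I ≠ ⊤) {r : R} (hr : r ∈ onePlus I) : r ∉ I := by
  intro h
  apply hI
  rw [Ideal.eq_top_iff_one]
  have := I.sub_mem h hr
  rwa [sub_sub_cancel] at this

/-- An element outside the maximal ideal has a multiple in `1 + I`, so inverting `1 + I` amounts to
localizing at the prime `I`. -/
lemma isUnit_algebraMap_onePlus_iff (I : Ideal R) [hI : I.IsMaximal] {b : R} :
    IsUnit (algebraMap R (Localization (onePlus I)) b) ↔ b ∉ I := by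
  constructor
  · intro hu hb
    obtain ⟨c, hc⟩ := hu.exists_right_inv
    obtain ⟨c, s, rfl⟩ := IsLocalization.exists_mk'_eq (onePlus I) c
    rw [IsLocalization.mul_mk'_eq_mk'_of_mul, IsLocalization.mk'_eq_iff_eq_mul, one_mul,
      IsLocalization.eq_iff_exists (onePlus I)] at hc
    obtain ⟨v, hv⟩ := hc
    refine notMem_of_mem_onePlus hI.ne_top (v * s).2 ?_
    rw [Submonoid.coe_mul, ← hv]
    exact I.mul_mem_left _ (I.mul_mem_right _ hb)
  · intro hb
    obtain ⟨u, i, hi, h⟩ := hI.exists_inv hb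
    have hm : u * b ∈ onePlus I := by
      rw [mem_onePlus, ← h]
      simpa using hi
    have := IsLocalization.map_units (Localization (onePlus I)) ⟨u * b, hm⟩
    rw [map_mul] at this
    exact isUnit_of_mul_isUnit_right this

lemma isLocalRing_localization_onePlus (I : Ideal R) [hI : I.IsMaximal] :
    IsLocalRing (Localization (onePlus I)) := by
  have : Nontrivial (Localization (onePlus I)) := by
    rw [← not_subsingleton_iff_nontrivial, IsLocalization.subsingleton_iff (M := onePlus I)]
    exact fun h => notMem_of_mem_onePlus hI.ne_top h I.zero_mem
  refine .of_isUnit_or_isUnit_one_sub_self fun a => ?_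
  obtain ⟨b, s, rfl⟩ := IsLocalization.exists_mk'_eq (onePlus I) a
  have hs := IsLocalization.map_units (Localization (onePlus I)) s
  have h1 : IsLocalization.mk' (Localization (onePlus I)) b s * algebraMap R _ s =
      algebraMap R _ b := IsLocalization.mk'_spec _ _ _
  by_cases hb : b ∈ I
  · right
    have h2 : (1 - IsLocalization.mk' (Localization (onePlus I)) b s) * algebraMap R _ s =
        algebraMap R _ (s - b) := by
      rw [sub_mul, h1, one_mul, map_sub]
    refine isUnit_of_mul_isUnit_left (y := algebraMap R _ s) ?_
    rw [h2, isUnit_algebraMap_onePlus_iff]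
    intro h
    exact notMem_of_mem_onePlus hI.ne_top s.2 (by simpa using I.add_mem h hb)
  · left
    refine isUnit_of_mul_isUnit_left (y := algebraMap R _ s) ?_
    rwa [h1, isUnit_algebraMap_onePlus_iff]

end OnePlus

/-! ### The residually rational point defined by `M` and a generating set -/

section Origin

variable {A R : Type*} [CommRing A] [IsLocalRing A] [CommRing R] [Algebra A R]

lemma algebraMap_mem_originIdeal (T : Set R) {a : A} (ha : a ∈ IsLocalRing.maximalIdeal A) :
    algebraMap A R a ∈ originIdeal A T :=
  Ideal.mem_sup_left (Ideal.mem_map_of_mem _ ha)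

lemma mem_originIdeal {T : Set R} {t : R} (ht : t ∈ T) : t ∈ originIdeal A T :=
  Ideal.mem_sup_right (Ideal.subset_span ht)

lemma mem_maximalIdeal_of_algebraMap_mem {I : Ideal R} (hI : I ≠ ⊤) {a : A}
    (ha : algebraMap A R a ∈ I) : a ∈ IsLocalRing.maximalIdeal A := by
  rw [IsLocalRing.mem_maximalIdeal]
  exact fun hu => hI (I.eq_top_of_isUnit_mem ha (hu.map _))

lemma exists_sub_algebraMap_mem {T : Set R} (hT : Algebra.adjoin A T = ⊤) (b : R) :
    ∃ a : A, b - algebraMap A R a ∈ originIdeal A T := by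
  have hb : b ∈ Algebra.adjoin A T := hT ▸ Algebra.mem_top
  induction hb using Algebra.adjoin_induction with
  | mem x hx => exact ⟨0, by simpa using mem_originIdeal hx⟩
  | algebraMap r => exact ⟨r, by simp⟩
  | add x y _ _ hx hy =>
    obtain ⟨a, ha⟩ := hx
    obtain ⟨c, hc⟩ := hy
    refine ⟨a + c, ?_⟩
    rw [map_add, add_sub_add_comm]
    exact Ideal.add_mem _ ha hc
  | mul x y _ _ hx hy =>
    obtain ⟨a, ha⟩ := hx
    obtain ⟨c, hc⟩ := hy
    refine ⟨a * c, ?_⟩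
    have : x * y - algebraMap A R (a * c) =
      y * (x - algebraMap A R a) + algebraMap A R a * (y - algebraMap A R c) := by
      rw [map_mul]; ring
    rw [this]
    exact Ideal.add_mem _ (Ideal.mul_mem_left _ _ ha) (Ideal.mul_mem_left _ _ hc)

/-- The map from `A` to the quotient by `originIdeal A T` is surjective and kills `M`, so an element
outside the ideal is congruent to a unit of `A`. -/
lemma isMaximal_originIdeal {T : Set R} (hT : Algebra.adjoin A T = ⊤)
    (hI : originIdeal A T ≠ ⊤) : (originIdeal A T).IsMaximal := by
  rw [Ideal.isMaximal_iff]
  refine ⟨(Ideal.ne_top_iff_one _).1 hI, fun J b hIJ hb hbJ => ?_⟩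
  obtain ⟨a, ha⟩ := exists_sub_algebraMap_mem hT b
  have hu : IsUnit a := by
    by_contra h
    apply hb
    have := Ideal.add_mem _ ha (algebraMap_mem_originIdeal T ((IsLocalRing.mem_maximalIdeal a).2 h))
    rwa [sub_add_cancel] at this
  have : algebraMap A R a ∈ J := by
    have := J.sub_mem hbJ (hIJ ha)
    rwa [sub_sub_cancel] at this
  exact (Ideal.eq_top_iff_one _).1 (J.eq_top_of_isUnit_mem this (hu.map _))

end Origin

/-- First-order Taylor expansion. It serves twice: at the origin of `B` with increment `x`, and for
the Newton correction in the proof of injectivity. -/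
lemma aeval_add_sub_mem_sq {A R σ : Type*} [CommRing A] [CommRing R] [Algebra A R] [Fintype σ]
    (J : Ideal R) (z δ : σ → R) (hδ : ∀ i, δ i ∈ J) (p : MvPolynomial σ A) :
    MvPolynomial.aeval (z + δ) p - MvPolynomial.aeval z p -
      ∑ i, δ i * MvPolynomial.aeval z (MvPolynomial.pderiv i p) ∈ J ^ 2 := by
  classical
  induction p using MvPolynomial.induction_on with
  | C a => simp
  | add p q hp hq =>
    convert Ideal.add_mem _ hp hq using 1
    simp only [map_add, mul_add, Finset.sum_add_distrib]
    ring
  | mul_X p k hp =>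
    have hd : ∑ i, δ i * MvPolynomial.aeval z (MvPolynomial.pderiv i p) ∈ J :=
      Ideal.sum_mem _ fun i _ => J.mul_mem_right _ (hδ i)
    have h1 := Ideal.mul_mem_right ((z + δ) k) _ hp
    have h2 : (∑ i, δ i * MvPolynomial.aeval z (MvPolynomial.pderiv i p)) * δ k ∈ J ^ 2 := by
      rw [pow_two]; exact Ideal.mul_mem_mul hd (hδ k)
    convert Ideal.add_mem _ h1 h2 using 1
    have : ∑ i, δ i * MvPolynomial.aeval z (MvPolynomial.pderiv i (p * MvPolynomial.X k)) =
        (∑ i, δ i * MvPolynomial.aeval z (MvPolynomial.pderiv i p)) * z k +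
          δ k * MvPolynomial.aeval z p := by
      have h3 : ∀ i, δ i * MvPolynomial.aeval z (MvPolynomial.pderiv i (p * MvPolynomial.X k)) =
          δ i * MvPolynomial.aeval z (MvPolynomial.pderiv i p) * z k +
            if k = i then δ i * MvPolynomial.aeval z p else 0 := by
        intro i
        rw [MvPolynomial.pderiv_mul, MvPolynomial.pderiv_X, Pi.single_apply]
        split_ifs with h
        · simp [mul_add]; ring
        · simp; ring
      simp_rw [h3, Finset.sum_add_distrib, ← Finset.sum_mul]
      simp
    rw [this]
    simp only [map_mul, MvPolynomial.aeval_X, Pi.add_apply]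
    ring

/-! ### The algebra `B` near the origin -/

section System

variable {A : Type*} [CommRing A] {n : ℕ} (F : Fin n → MvPolynomial (Fin n) A)

lemma aeval_coord (p : MvPolynomial (Fin n) A) :
    MvPolynomial.aeval (coord F) p = Ideal.Quotient.mk (Ideal.span (Set.range F)) p := by
  have : MvPolynomial.aeval (coord F) = Ideal.Quotient.mkₐ A (Ideal.span (Set.range F)) := by
    ext i
    simp [coord]
  rw [this]
  rfl

lemma aeval_coord_apply (j : Fin n) : MvPolynomial.aeval (coord F) (F j) = 0 := by
  rw [aeval_coord, Ideal.Quotient.eq_zero_iff_mem]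
  exact Ideal.subset_span ⟨j, rfl⟩

lemma adjoin_range_coord : Algebra.adjoin A (Set.range (coord F)) = ⊤ := by
  rw [Algebra.adjoin_range_eq_range_aeval, AlgHom.range_eq_top]
  intro b
  obtain ⟨p, rfl⟩ := Ideal.Quotient.mk_surjective b
  exact ⟨p, aeval_coord F p⟩

variable [IsLocalRing A] {F}

/-- Evaluation at the origin followed by reduction modulo `M` kills every `f_i`, hence factors
through `B`, and its kernel contains `M_B`. -/
lemma maxIdeal_ne_top (hF : ∀ i, MvPolynomial.eval 0 (F i) ∈ IsLocalRing.maximalIdeal A) :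
    maxIdeal F ≠ ⊤ := by
  let g : QuotientRing F →+* IsLocalRing.ResidueField A :=
    Ideal.Quotient.lift _ ((IsLocalRing.residue A).comp (MvPolynomial.eval 0)) fun a ha => by
      rw [← RingHom.mem_ker]
      refine (Ideal.span_le (I := RingHom.ker _)).2 ?_ ha
      rintro _ ⟨i, rfl⟩
      simpa [RingHom.mem_ker] using hF i
  have hle : maxIdeal F ≤ RingHom.ker g := by
    refine sup_le ?_ ?_
    · rw [Ideal.map_le_iff_le_comap]
      intro a ha
      rw [Ideal.mem_comap, RingHom.mem_ker]
      have : algebraMap A (QuotientRing F) a =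
        Ideal.Quotient.mk (Ideal.span (Set.range F)) (MvPolynomial.C a) := rfl
      rw [this]
      simpa [g] using ha
    · rw [Ideal.span_le]
      rintro _ ⟨i, rfl⟩
      simp [g, coord]
  exact fun h => RingHom.ker_ne_top g (top_le_iff.1 (h ▸ hle))

lemma isMaximal_maxIdeal (hF : ∀ i, MvPolynomial.eval 0 (F i) ∈ IsLocalRing.maximalIdeal A) :
    (maxIdeal F).IsMaximal :=
  isMaximal_originIdeal (adjoin_range_coord F) (maxIdeal_ne_top hF)

/-- A residually simple zero has no infinitesimal neighbours in the residual fibre. -/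
lemma exists_onePlus_mul_mem_map (hF : IsHenselSystem F) :
    ∃ t ∈ onePlus (maxIdeal F), ∀ b ∈ maxIdeal F,
      t * b ∈ (IsLocalRing.maximalIdeal A).map (algebraMap A (QuotientRing F)) := by
  classical
  set P := (IsLocalRing.maximalIdeal A).map (algebraMap A (QuotientRing F)) with hP
  set I := maxIdeal F with hI
  have hxI : ∀ i, coord F i ∈ I := fun i => mem_originIdeal ⟨i, rfl⟩
  have hlin : ∀ j, ∑ i, coord F i *
      algebraMap A (QuotientRing F) (MvPolynomial.eval 0 (MvPolynomial.pderiv i (F j))) ∈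
        P ⊔ I ^ 2 := by
    intro j
    have h := aeval_add_sub_mem_sq I 0 (coord F) hxI (F j)
    rw [zero_add, aeval_coord_apply] at h
    have hz : ∀ p : MvPolynomial (Fin n) A,
        MvPolynomial.aeval (0 : Fin n → QuotientRing F) p =
          algebraMap A _ (MvPolynomial.eval 0 p) := by
      intro p
      simp [MvPolynomial.aeval_zero, MvPolynomial.eval_zero]
    simp_rw [hz] at h
    have h0 : algebraMap A (QuotientRing F) (MvPolynomial.eval 0 (F j)) ∈ P ⊔ I ^ 2 :=
      Ideal.mem_sup_left (Ideal.mem_map_of_mem _ (hF.eval_mem j))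
    have := neg_mem (Ideal.add_mem _ (Ideal.mem_sup_right (S := P) h) h0)
    convert this using 1
    ring
  let m : Matrix (Fin n) (Fin n) A :=
    Matrix.of fun i j => MvPolynomial.eval 0 (MvPolynomial.pderiv i (F j))
  have hdet : IsUnit m.det := by
    have : m.det = MvPolynomial.eval 0 (jacobian F) := by
      rw [jacobian, RingHom.map_det]
      rfl
    rw [this]
    exact hF.isUnit_jacobian
  -- The inverse Jacobian matrix solves the linearized equations for the coordinates.
  have hx : ∀ k, coord F k ∈ P ⊔ I ^ 2 := by
    intro k
    have : coord F k = ∑ j, (∑ i, coord F i * algebraMap A _ (m i j)) *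
        algebraMap A _ (m⁻¹ j k) := by
      simp_rw [Finset.sum_mul, mul_assoc, ← map_mul]
      rw [Finset.sum_comm]
      simp_rw [← Finset.mul_sum, ← map_sum, ← Matrix.mul_apply, Matrix.mul_nonsing_inv m hdet,
        Matrix.one_apply]
      simp
    rw [this]
    exact Ideal.sum_mem _ fun j _ => Ideal.mul_mem_right _ _ (hlin j)
  have hle : I ≤ P ⊔ I ^ 2 := by
    refine sup_le le_sup_left ?_
    rw [Ideal.span_le]
    rintro _ ⟨k, rfl⟩
    exact hx k
  -- Nakayama is applied to the image of `I` in `B / P`, which is finitely generated by the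
  -- coordinates even when `M` is not finitely generated.
  let N : Submodule (QuotientRing F) (QuotientRing F ⧸ P) := Submodule.map P.mkQ I
  have hN : N = Submodule.map P.mkQ (Ideal.span (Set.range (coord F))) := by
    have : Submodule.map P.mkQ P = ⊥ := by
      exact Submodule.mkQ_map_self P
    change Submodule.map P.mkQ (P ⊔ _) = _
    rw [Submodule.map_sup, this, bot_sup_eq]
  obtain ⟨t, ht, h⟩ := Submodule.exists_sub_one_mem_and_smul_eq_zero_of_fg_of_le_smul I N
    (by rw [hN]; exact (Submodule.fg_span (Set.finite_range _)).map _) (by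
      have := Submodule.map_mono (f := P.mkQ) hle
      rw [Submodule.map_sup, pow_two, ← smul_eq_mul, Submodule.map_smul''] at this
      have h2 : Submodule.map P.mkQ P = ⊥ := by
        exact Submodule.mkQ_map_self P
      rwa [h2, bot_sup_eq] at this)
  refine ⟨t, ht, fun b hb => ?_⟩
  have := h _ (Submodule.mem_map_of_mem hb)
  rwa [← map_smul, ← LinearMap.mem_ker, Submodule.ker_mkQ] at this

end System

/-- Zariski's main theorem at an unramified residually rational point. -/
lemma exists_onePlus_isIntegral {A B : Type*} [CommRing A] [IsLocalRing A] [CommRing B]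
    [Algebra A B] {T : Set B} (hTf : T.Finite) (hT : Algebra.adjoin A T = ⊤)
    (hI : originIdeal A T ≠ ⊤) {t : B} (ht : t ∈ onePlus (originIdeal A T))
    (htI : ∀ b ∈ originIdeal A T, t * b ∈ (IsLocalRing.maximalIdeal A).map (algebraMap A B)) :
    ∃ r ∈ onePlus (originIdeal A T), IsIntegral A r ∧ ∀ x ∈ T, IsIntegral A (r * x) := by
  set I := originIdeal A T with hIdef
  have hmax : I.IsMaximal := isMaximal_originIdeal hT hI
  have : Algebra.FiniteType A B := ⟨⟨hTf.toFinset, by simpa using hT⟩⟩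
  have hunder : I.under A = IsLocalRing.maximalIdeal A := by
    ext a
    exact ⟨fun h => mem_maximalIdeal_of_algebraMap_mem hI h, algebraMap_mem_originIdeal T⟩
  have hq : Algebra.WeaklyQuasiFiniteAt A I := by
    rw [Algebra.weaklyQuasiFiniteAt_iff, hunder]
    -- The fibre is generated by `1` over `A`: if `b ≡ a` and `s ≡ c` modulo `I`, then `b / s` is
    -- represented by `a / c`, because `t` is a unit at `I` and carries `I` into `M B`.
    have : Module.Finite A (Localization.AtPrime I ⧸
        (IsLocalRing.maximalIdeal A).map (algebraMap A (Localization.AtPrime I))) := by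
      refine Module.Finite.of_surjective (Algebra.linearMap A _) fun z => ?_
      obtain ⟨z, rfl⟩ := Ideal.Quotient.mk_surjective z
      obtain ⟨b, s, rfl⟩ := IsLocalization.exists_mk'_eq I.primeCompl z
      obtain ⟨a, ha⟩ := exists_sub_algebraMap_mem hT b
      obtain ⟨c, hc⟩ := exists_sub_algebraMap_mem hT (s : B)
      have hcu : IsUnit c := by
        by_contra h
        apply s.2
        have := I.add_mem hc (algebraMap_mem_originIdeal T ((IsLocalRing.mem_maximalIdeal c).2 h))
        rwa [sub_add_cancel] at this
      obtain ⟨d, hd⟩ := hcu.exists_right_inv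
      refine ⟨a * d, ?_⟩
      have hbs : b - algebraMap A B (a * d) * s ∈ I := by
        have : b - algebraMap A B (a * d) * s = (b - algebraMap A B a)
            - algebraMap A B (a * d) * (s - algebraMap A B c) := by
          have : algebraMap A B (a * d) * algebraMap A B c = algebraMap A B a := by
            rw [← map_mul, mul_assoc, mul_comm d, hd, mul_one]
          rw [mul_sub, this]; ring
        rw [this]
        exact I.sub_mem ha (I.mul_mem_left _ hc)
      have hmem := Ideal.mem_map_of_mem (algebraMap B (Localization.AtPrime I)) (htI _ hbs)
      rw [Ideal.map_map, ← IsScalarTower.algebraMap_eq] at hmem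
      have htu : IsUnit (algebraMap B (Localization.AtPrime I) t) :=
        IsLocalization.map_units (M := I.primeCompl) _ ⟨t, notMem_of_mem_onePlus hI ht⟩
      have hsu : IsUnit (algebraMap B (Localization.AtPrime I) s) :=
        IsLocalization.map_units _ s
      rw [map_mul, Ideal.unit_mul_mem_iff_mem _ htu] at hmem
      change Ideal.Quotient.mk _ (algebraMap A (Localization.AtPrime I) (a * d)) = _
      rw [eq_comm, Ideal.Quotient.eq]
      rw [← Ideal.mul_unit_mem_iff_mem _ hsu, sub_mul, IsLocalization.mk'_spec]
      rwa [map_sub, map_mul, ← IsScalarTower.algebraMap_apply] at hmem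
    infer_instance
  obtain ⟨r, hr, hri, H⟩ := Algebra.zariskisMainProperty_iff.1
    (Algebra.ZariskisMainProperty.of_finiteType_of_weaklyQuasiFiniteAt (R := A) I)
  choose m hm using H
  obtain ⟨c, hc⟩ := exists_sub_algebraMap_mem hT (r ^ (hTf.toFinset.sup m + 1))
  have hrp : r ^ (hTf.toFinset.sup m + 1) ∉ I := fun h => hr (hmax.isPrime.mem_of_pow_mem _ h)
  have hcu : IsUnit c := by
    by_contra h
    apply hrp
    have := I.add_mem hc (algebraMap_mem_originIdeal T ((IsLocalRing.mem_maximalIdeal c).2 h))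
    rwa [sub_add_cancel] at this
  obtain ⟨d, hd⟩ := hcu.exists_right_inv
  -- One power of `r` serves all generators in `T`; dividing by its residual value `c` moves it into
  -- `1 + I`.
  refine ⟨algebraMap A B d * r ^ (hTf.toFinset.sup m + 1), ?_,
    isIntegral_algebraMap.mul (hri.pow _), fun x hx => ?_⟩
  · rw [mem_onePlus]
    have : algebraMap A B d * r ^ (hTf.toFinset.sup m + 1) - 1 =
        algebraMap A B d * (r ^ (hTf.toFinset.sup m + 1) - algebraMap A B c) := by
      rw [mul_sub, ← map_mul, mul_comm d c, hd, map_one]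
    rw [this]
    exact I.mul_mem_left _ hc
  · have hle : m x ≤ hTf.toFinset.sup m := Finset.le_sup (by simpa using hx)
    obtain ⟨k, hk⟩ := Nat.exists_eq_add_of_le hle
    have : algebraMap A B d * r ^ (hTf.toFinset.sup m + 1) * x =
        algebraMap A B d * r ^ (k + 1) * (r ^ m x * x) := by
      rw [hk]; ring
    rw [this]
    exact (isIntegral_algebraMap.mul (hri.pow _)).mul (hm x)

/-! ### Clearing denominators in subalgebras, and polynomials in one element -/

section Subalgebra

variable {A B : Type*} [CommRing A] [CommRing B] [Algebra A B]

lemma mul_mem_ideal_smul {M : Ideal A} {C D : Submodule A B} {b : B} (h : ∀ c ∈ C, b * c ∈ D)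
    {w : B} (hw : w ∈ M • C) : b * w ∈ M • D := by
  induction hw using Submodule.smul_induction_on' with
  | smul a ha c hc =>
    rw [mul_smul_comm]
    exact Submodule.smul_mem_smul ha (h c hc)
  | add x _ y _ hx hy =>
    rw [mul_add]
    exact add_mem hx hy

/-- This is the equality of `B` and `C` after inverting `r`, in denominator-free form. -/
lemma exists_pow_mul_mem {T : Set B} (hT : Algebra.adjoin A T = ⊤) {C : Subalgebra A B} {r : B}
    (hr : r ∈ C) (hrT : ∀ x ∈ T, r * x ∈ C) (b : B) : ∃ k : ℕ, r ^ k * b ∈ C := by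
  have hb : b ∈ Algebra.adjoin A T := hT ▸ Algebra.mem_top
  induction hb using Algebra.adjoin_induction with
  | mem x hx => exact ⟨1, by simpa using hrT x hx⟩
  | algebraMap a => exact ⟨0, by simp⟩
  | add x y _ _ hx hy =>
    obtain ⟨k, hk⟩ := hx
    obtain ⟨m, hm⟩ := hy
    refine ⟨k + m, ?_⟩
    have : r ^ (k + m) * (x + y) = r ^ m * (r ^ k * x) + r ^ k * (r ^ m * y) := by ring
    rw [this]
    exact add_mem (mul_mem (pow_mem hr _) hk) (mul_mem (pow_mem hr _) hm)
  | mul x y _ _ hx hy =>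
    obtain ⟨k, hk⟩ := hx
    obtain ⟨m, hm⟩ := hy
    refine ⟨k + m, ?_⟩
    have : r ^ (k + m) * (x * y) = (r ^ k * x) * (r ^ m * y) := by ring
    rw [this]
    exact mul_mem hk hm

lemma exists_pow_mul_mem_smul {T : Set B} (hT : Algebra.adjoin A T = ⊤) {C : Subalgebra A B}
    {r : B} (hr : r ∈ C) (hrT : ∀ x ∈ T, r * x ∈ C) {M : Ideal A} {b : B}
    (hb : b ∈ M.map (algebraMap A B)) : ∃ k : ℕ, r ^ k * b ∈ M • Subalgebra.toSubmodule C := by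
  have hb' : b ∈ M • (⊤ : Submodule A B) := by
    rw [Ideal.smul_top_eq_map]; exact hb
  induction hb' using Submodule.smul_induction_on' with
  | smul a ha c hc =>
    obtain ⟨k, hk⟩ := exists_pow_mul_mem hT hr hrT c
    refine ⟨k, ?_⟩
    rw [mul_smul_comm]
    exact Submodule.smul_mem_smul ha hk
  | add x hx' y hy' hx hy =>
    rw [Ideal.smul_top_eq_map] at hx' hy'
    obtain ⟨k, hk⟩ := hx hx'
    obtain ⟨m, hm⟩ := hy hy'
    refine ⟨k + m, ?_⟩
    have : r ^ (k + m) * (x + y) = r ^ m * (r ^ k * x) + r ^ k * (r ^ m * y) := by ring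
    rw [this]
    exact add_mem (mul_mem_ideal_smul (fun c hc => C.mul_mem (pow_mem hr m) hc) hk)
      (mul_mem_ideal_smul (fun c hc => C.mul_mem (pow_mem hr k) hc) hm)

/-- Modulo `M C`, the element `e` is a common eigenvector of the generators, hence of all of `C`. -/
lemma exists_mul_sub_smul_mem {C : Subalgebra A B} {e : B} {M : Ideal A} {G : Set B}
    (hG : Algebra.adjoin A G = C)
    (h : ∀ g ∈ G, ∃ a : A, e * g - a • e ∈ M • Subalgebra.toSubmodule C) {c : B} (hc : c ∈ C) :
    ∃ a : A, e * c - a • e ∈ M • Subalgebra.toSubmodule C := by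
  subst hG
  induction hc using Algebra.adjoin_induction with
  | mem x hx => exact h x hx
  | algebraMap a => exact ⟨a, by simp [Algebra.smul_def, mul_comm]⟩
  | add x y _ _ hx hy =>
    obtain ⟨a, ha⟩ := hx
    obtain ⟨b, hb⟩ := hy
    refine ⟨a + b, ?_⟩
    have : e * (x + y) - (a + b) • e = (e * x - a • e) + (e * y - b • e) := by
      rw [add_smul]; ring
    rw [this]
    exact add_mem ha hb
  | mul x y _ hy' hx hy =>
    obtain ⟨a, ha⟩ := hx
    obtain ⟨b, hb⟩ := hy
    refine ⟨a * b, ?_⟩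
    have : e * (x * y) - (a * b) • e = y * (e * x - a • e) + a • (e * y - b • e) := by
      simp only [Algebra.smul_def, map_mul]; ring
    rw [this]
    exact add_mem (mul_mem_ideal_smul (fun c hc => Subalgebra.mul_mem _ hy' hc) ha)
      (Submodule.smul_mem _ _ hb)

lemma exists_aeval_eq {y z : B} (hz : z ∈ Algebra.adjoin A {y}) :
    ∃ p : Polynomial A, Polynomial.aeval y p = z := by
  rw [Algebra.adjoin_singleton_eq_range_aeval] at hz
  exact hz

lemma aeval_sub_eval_zero (y : B) (p : Polynomial A) :
    ∃ z ∈ Algebra.adjoin A {y},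
      Polynomial.aeval y p = algebraMap A B (p.eval 0) + y * z := by
  refine ⟨Polynomial.aeval y p.divX, Polynomial.aeval_mem_adjoin_singleton A y, ?_⟩
  conv_lhs => rw [← Polynomial.divX_mul_X_add p]
  rw [map_add, map_mul, Polynomial.aeval_X, Polynomial.aeval_C, Polynomial.coeff_zero_eq_eval_zero]
  ring

lemma exists_polynomial_of_mem_smul {M : Ideal A} {y w : B}
    (hw : w ∈ M • Subalgebra.toSubmodule (Algebra.adjoin A {y})) :
    ∃ g : Polynomial A, (∀ i, g.coeff i ∈ M) ∧ Polynomial.aeval y g = w := by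
  induction hw using Submodule.smul_induction_on' with
  | smul a ha c hc =>
    obtain ⟨p, rfl⟩ := exists_aeval_eq hc
    refine ⟨a • p, fun i => ?_, by simp⟩
    rw [Polynomial.coeff_smul, smul_eq_mul]
    exact M.mul_mem_right _ ha
  | add x _ y _ hx hy =>
    obtain ⟨p, hp, rfl⟩ := hx
    obtain ⟨q, hq, rfl⟩ := hy
    exact ⟨p + q, fun i => by rw [Polynomial.coeff_add]; exact M.add_mem (hp i) (hq i), by simp⟩

end Subalgebra

/-! ### Passing from a finite algebra to one generator -/

section Generator

variable {A B : Type*} [CommRing A] [IsLocalRing A] [CommRing B] [Algebra A B]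

/-- The element `t` sends each `c` into `M B`, and a power of `r` carries the result into `M C`. A
further power of `r` puts the multiplier itself in `C`. -/
lemma exists_onePlus_mul_mem_smul {T : Set B} (hT : Algebra.adjoin A T = ⊤) {C : Subalgebra A B}
    {r : B} (hr : r ∈ C) (hrI : r ∈ onePlus (originIdeal A T)) (hrT : ∀ x ∈ T, r * x ∈ C)
    {t : B} (ht : t ∈ onePlus (originIdeal A T))
    (htI : ∀ b ∈ originIdeal A T, t * b ∈ (IsLocalRing.maximalIdeal A).map (algebraMap A B))
    (s : Finset B) (hs : ∀ c ∈ s, c ∈ originIdeal A T) :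
    ∃ e ∈ C, e ∈ onePlus (originIdeal A T) ∧
      ∀ c ∈ s, e * c ∈ IsLocalRing.maximalIdeal A • Subalgebra.toSubmodule C := by
  classical
  obtain ⟨k, hk⟩ := exists_pow_mul_mem hT hr hrT t
  have hpow : ∀ c ∈ s, ∃ m : ℕ,
      r ^ m * (t * c) ∈ IsLocalRing.maximalIdeal A • Subalgebra.toSubmodule C :=
    fun c hc => exists_pow_mul_mem_smul hT hr hrT (htI c (hs c hc))
  choose! m hm using hpow
  refine ⟨r ^ s.sup m * (r ^ k * t), mul_mem (pow_mem hr _) hk,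
    mul_mem (pow_mem hrI _) (mul_mem (pow_mem hrI _) ht), fun c hc => ?_⟩
  obtain ⟨j, hj⟩ := Nat.exists_eq_add_of_le (Finset.le_sup (f := m) hc)
  have : r ^ s.sup m * (r ^ k * t) * c = r ^ (j + k) * (r ^ m c * (t * c)) := by
    rw [hj]; ring
  rw [this]
  exact mul_mem_ideal_smul (fun c hc => C.mul_mem (pow_mem hr _) hc) (hm c hc)

/-- The ideal `M A[y] + y A[y]` of the algebra generated by `y`. -/
abbrev adjoinIdeal (A : Type*) {B : Type*} [CommRing A] [IsLocalRing A] [CommRing B] [Algebra A B]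
    (y : B) : Ideal (Algebra.adjoin A {y}) :=
  originIdeal A {(⟨y, Algebra.self_mem_adjoin_singleton A y⟩ : Algebra.adjoin A {y})}

lemma coe_mem_of_mem_adjoinIdeal {T : Set B} {y : B} (hy : y ∈ originIdeal A T)
    {z : Algebra.adjoin A {y}} (hz : z ∈ adjoinIdeal A y) : (z : B) ∈ originIdeal A T := by
  have : adjoinIdeal A y ≤ (originIdeal A T).comap (Algebra.adjoin A {y}).val := by
    refine sup_le ?_ ?_
    · rw [Ideal.map_le_iff_le_comap]
      exact fun a ha => algebraMap_mem_originIdeal T ha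
    · rw [Ideal.span_singleton_le_iff_mem]
      exact hy
  exact this hz

/-- Writing `z = p(y)`, the constant `p(0) - 1` lies in the proper ideal, so it is not a unit of
`A`. -/
lemma mem_onePlus_adjoinIdeal {T : Set B} (hI : originIdeal A T ≠ ⊤) {y : B}
    (hy : y ∈ originIdeal A T) {z : Algebra.adjoin A {y}}
    (hz : (z : B) ∈ onePlus (originIdeal A T)) : z ∈ onePlus (adjoinIdeal A y) := by
  obtain ⟨p, hp⟩ := exists_aeval_eq z.2
  obtain ⟨w, hw, h⟩ := aeval_sub_eval_zero y p
  have ha : p.eval 0 - 1 ∈ IsLocalRing.maximalIdeal A := by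
    refine mem_maximalIdeal_of_algebraMap_mem hI (R := B) ?_
    have : algebraMap A B (p.eval 0 - 1) = (z - 1) - y * w := by
      rw [← hp, h, map_sub, map_one]; ring
    rw [this]
    exact Ideal.sub_mem _ hz (Ideal.mul_mem_right _ _ hy)
  have : z - 1 = algebraMap A _ (p.eval 0 - 1) +
      (⟨y, Algebra.self_mem_adjoin_singleton A y⟩ : Algebra.adjoin A {y}) * ⟨w, hw⟩ := by
    ext
    simp [← hp, h]
    ring
  rw [mem_onePlus, this]
  exact Ideal.add_mem _ (algebraMap_mem_originIdeal _ ha)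
    (Ideal.mul_mem_right _ _ (mem_originIdeal rfl))

/-- If `C` is finite over `A` and `(1 - y) C ⊆ A (1 - y) + M C`, then `A[y]` and `C` agree
after inverting an element of `1 + M + y A[y]`. -/
lemma exists_onePlus_adjoinIdeal_mul_mem {C : Subalgebra A B}
    (hC : (Subalgebra.toSubmodule C).FG) {y : B}
    (h : ∀ c ∈ C, ∃ a : A, (1 - y) * c - a • (1 - y) ∈
      IsLocalRing.maximalIdeal A • Subalgebra.toSubmodule C) :
    ∃ q ∈ onePlus (adjoinIdeal A y), ∀ c ∈ C, (q : B) * c ∈ Algebra.adjoin A {y} := by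
  obtain ⟨s, hs⟩ := hC
  set Y := Algebra.adjoin A {y} with hY
  let y' : Y := ⟨y, Algebra.self_mem_adjoin_singleton A y⟩
  -- `A[y]` is viewed as a `Y`-submodule of `B`, so that Nakayama can be run on the image of `C` in
  -- the quotient.
  let Y₀ : Submodule Y B := Submodule.span Y {1}
  have hY₀ : ∀ b : B, b ∈ Y₀ ↔ b ∈ Y := by
    intro b
    rw [Submodule.mem_span_singleton]
    constructor
    · rintro ⟨a, rfl⟩
      rw [Algebra.smul_def, mul_one]
      exact a.2
    · exact fun hb => ⟨⟨b, hb⟩, by rw [Algebra.smul_def, mul_one]; rfl⟩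
  let S : Submodule Y B := Submodule.span Y (s : Set B)
  have hCS : ∀ c ∈ C, c ∈ S := by
    intro c hc
    have : c ∈ Submodule.span A (s : Set B) := by rw [hs]; exact hc
    exact Submodule.span_le_restrictScalars A Y _ this
  have hMC : ∀ w ∈ IsLocalRing.maximalIdeal A • Subalgebra.toSubmodule C,
      w ∈ adjoinIdeal A y • S := by
    intro w hw
    induction hw using Submodule.smul_induction_on' with
    | smul a ha c hc =>
      rw [← algebraMap_smul Y a c]
      exact Submodule.smul_mem_smul (algebraMap_mem_originIdeal _ ha) (hCS c hc)
    | add x _ y _ hx hy => exact add_mem hx hy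
  have hSle : S ≤ Y₀ ⊔ adjoinIdeal A y • S := by
    rw [Submodule.span_le]
    intro c hcs
    have hc : c ∈ C := by
      rw [← Subalgebra.mem_toSubmodule, ← hs]; exact Submodule.subset_span hcs
    obtain ⟨a, ha⟩ := h c hc
    -- Split `c = (1 - y) c + y c` and replace the first term by `a (1 - y)` modulo `M C`.
    have : c = a • (1 - y) + (((1 - y) * c - a • (1 - y)) + y' • c) := by
      rw [Subalgebra.smul_def, smul_eq_mul]; ring
    rw [SetLike.mem_coe, this]
    refine Submodule.add_mem_sup ?_ (add_mem (hMC _ ha) ?_)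
    · rw [hY₀]
      exact Y.smul_mem (sub_mem (one_mem _) y'.2) a
    · exact Submodule.smul_mem_smul (mem_originIdeal rfl) (hCS c hc)
  obtain ⟨q, hq, hqN⟩ := Submodule.exists_sub_one_mem_and_smul_eq_zero_of_fg_of_le_smul
    (adjoinIdeal A y) (S.map Y₀.mkQ) ((Submodule.fg_span s.finite_toSet).map _) (by
      have := Submodule.map_mono (f := Y₀.mkQ) hSle
      rwa [Submodule.map_sup, Submodule.mkQ_map_self, bot_sup_eq, Submodule.map_smul''] at this)
  refine ⟨q, hq, fun c hc => ?_⟩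
  have := hqN _ (Submodule.mem_map_of_mem (hCS c hc))
  rw [← map_smul, ← LinearMap.mem_ker, Submodule.ker_mkQ, hY₀] at this
  exact this

end Generator

lemma exists_adjoin_generator {A B : Type*} [CommRing A] [IsLocalRing A] [CommRing B]
    [Algebra A B] {T : Set B} (hTf : T.Finite) (hT : Algebra.adjoin A T = ⊤)
    (hI : originIdeal A T ≠ ⊤) {t : B} (ht : t ∈ onePlus (originIdeal A T))
    (htI : ∀ b ∈ originIdeal A T, t * b ∈ (IsLocalRing.maximalIdeal A).map (algebraMap A B)) :
    ∃ y ∈ originIdeal A T, IsIntegral A y ∧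
      (∃ h : Polynomial A, Polynomial.aeval y h = 0 ∧ h.coeff 0 ∈ IsLocalRing.maximalIdeal A ∧
        h.coeff 1 ∈ onePlus (IsLocalRing.maximalIdeal A)) ∧
      ∀ x ∈ T, ∃ p q : Algebra.adjoin A {y}, q ∈ onePlus (adjoinIdeal A y) ∧ x * q = p := by
  classical
  obtain ⟨r, hrI, hri, hrT⟩ := exists_onePlus_isIntegral hTf hT hI ht htI
  set M := IsLocalRing.maximalIdeal A with hM
  set I := originIdeal A T with hIdef
  let G : Set B := insert r ((r * ·) '' T)
  set C := Algebra.adjoin A G with hC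
  have hGint : ∀ g ∈ G, IsIntegral A g := by
    rintro _ (rfl | ⟨x, hx, rfl⟩)
    exacts [hri, hrT x hx]
  have hCfg : (Subalgebra.toSubmodule C).FG :=
    fg_adjoin_of_finite ((hTf.image _).insert _) hGint
  have hrC : r ∈ C := Algebra.subset_adjoin (Set.mem_insert _ _)
  have hrTC : ∀ x ∈ T, r * x ∈ C := fun x hx =>
    Algebra.subset_adjoin (Set.mem_insert_of_mem _ ⟨x, hx, rfl⟩)
  -- These elements make `e r ≡ e` and `e (r x) ≡ 0` modulo `M C`, so each generator of `C` acts on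
  -- `e` by the scalar `1` or `0`.
  obtain ⟨e, heC, heI, he⟩ := exists_onePlus_mul_mem_smul hT hrC hrI hrTC ht htI
    (insert (r - 1) (hTf.toFinset.image (r * ·))) (by
      simp only [Finset.mem_insert, Finset.mem_image, Set.Finite.mem_toFinset]
      rintro _ (rfl | ⟨x, hx, rfl⟩)
      · exact hrI
      · exact Ideal.mul_mem_left _ _ (mem_originIdeal hx))
  have hgen : ∀ c ∈ C, ∃ a : A, e * c - a • e ∈ M • Subalgebra.toSubmodule C := by
    refine fun c hc => exists_mul_sub_smul_mem hC.symm ?_ hc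
    rintro g (hg | ⟨x, hx, rfl⟩)
    · refine ⟨1, ?_⟩
      convert he (r - 1) (by simp) using 1
      rw [one_smul, hg]; ring
    · refine ⟨0, ?_⟩
      convert he (r * x) (by simpa using Or.inr ⟨x, hx, rfl⟩) using 1
      rw [zero_smul, sub_zero]
  have hMC : ∀ w ∈ M • Subalgebra.toSubmodule C, w ∈ I := by
    intro w hw
    induction hw using Submodule.smul_induction_on' with
    | smul a ha c hc =>
      rw [Algebra.smul_def]
      exact I.mul_mem_right _ (algebraMap_mem_originIdeal T ha)
    | add x _ y _ hx hy => exact I.add_mem hx hy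
  obtain ⟨y, rfl⟩ : ∃ y, e = 1 - y := ⟨1 - e, by ring⟩
  have hyI : y ∈ I := by
    have := I.neg_mem heI
    rwa [neg_sub, sub_sub_cancel] at this
  have hyC : y ∈ C := by
    have := sub_mem (one_mem C) heC
    rwa [sub_sub_cancel] at this
  obtain ⟨q, hq, hqC⟩ := exists_onePlus_adjoinIdeal_mul_mem hCfg hgen
  have hqI : (q : B) ∈ onePlus I := by
    rw [mem_onePlus]
    exact coe_mem_of_mem_adjoinIdeal hyI hq
  refine ⟨y, hyI, ?_, ?_, fun x hx => ?_⟩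
  · exact IsIntegral.of_mem_of_fg C hCfg y hyC
  -- The scalar by which `y` acts on `1 - y` must lie in `M`, as seen modulo `I`, where `y` is `0`
  -- and `1 - y` is `1`.
  · have hey : (1 - y) * y ∈ M • Subalgebra.toSubmodule C := by
      obtain ⟨a, ha⟩ := hgen y hyC
      have haM : a ∈ M := by
        refine mem_maximalIdeal_of_algebraMap_mem hI ?_
        have : algebraMap A B a =
            (1 - y + algebraMap A B a) * y - ((1 - y) * y - a • (1 - y)) := by
          rw [Algebra.smul_def]; ring
        rw [this]
        exact I.sub_mem (I.mul_mem_left _ hyI) (hMC _ ha)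
      have := add_mem ha (Submodule.smul_mem_smul (I := M)
        (show a ∈ M from haM) (show 1 - y ∈ Subalgebra.toSubmodule C from heC))
      rwa [sub_add_cancel] at this
    have hqey : (q : B) * ((1 - y) * y) ∈
        M • Subalgebra.toSubmodule (Algebra.adjoin A {y}) := mul_mem_ideal_smul hqC hey
    obtain ⟨g, hg, hgy⟩ := exists_polynomial_of_mem_smul hqey
    obtain ⟨Q, hQ⟩ := exists_aeval_eq q.2
    obtain ⟨z, -, hz⟩ := aeval_sub_eval_zero y Q
    have hQ0 : Q.coeff 0 - 1 ∈ M := by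
      refine mem_maximalIdeal_of_algebraMap_mem hI ?_
      have : algebraMap A B (Q.coeff 0 - 1) = (q - 1) - y * z := by
        rw [← hQ, hz, map_sub, map_one, Polynomial.coeff_zero_eq_eval_zero]; ring
      rw [this]
      exact I.sub_mem hqI (I.mul_mem_right _ hyI)
    -- With `Q(y) = q` and `g(y) = q (1 - y) y`, this polynomial vanishes at `y`. Its coefficients
    -- in degrees `0` and `1` are `-g_0` and `Q_0 - g_1`.
    refine ⟨Q * (1 - Polynomial.X) * Polynomial.X - g, ?_, ?_, ?_⟩
    · rw [map_sub, hgy]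
      simp [hQ]
      ring
    · simpa using hg 0
    · rw [mem_onePlus, Polynomial.coeff_sub, Polynomial.coeff_mul_X, Polynomial.mul_coeff_zero]
      have := M.sub_mem hQ0 (hg 1)
      convert this using 1
      simp
      ring
  · refine ⟨⟨q * (r * x), hqC _ (hrTC x hx)⟩, ⟨q * r, hqC _ hrC⟩, ?_, ?_⟩
    · exact mem_onePlus_adjoinIdeal hI hyI (mul_mem hqI hrI)
    · change x * (q * r) = q * (r * x)
      ring

/-- A monic equation of `y` times `X ^ (h.natDegree + 2)` dominates `h` in degree and leaves the
coefficients in degrees `0` and `1` untouched. -/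
lemma exists_monic_aeval_eq_zero {A B : Type*} [CommRing A] [Nontrivial A] [CommRing B]
    [Algebra A B] {y : B} (hy : IsIntegral A y) {h : Polynomial A} (hh : Polynomial.aeval y h = 0) :
    ∃ f : Polynomial A, f.Monic ∧ Polynomial.aeval y f = 0 ∧ f.coeff 0 = h.coeff 0 ∧
      f.coeff 1 = h.coeff 1 := by
  obtain ⟨g, hg, hgy⟩ := hy
  refine ⟨Polynomial.X ^ (h.natDegree + 2) * g + h, ?_, ?_, ?_, ?_⟩
  · refine ((Polynomial.monic_X_pow _).mul hg).add_of_left ?_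
    rw [hg.degree_mul, Polynomial.degree_X_pow]
    refine (Polynomial.degree_le_natDegree).trans_lt ?_
    rw [Polynomial.degree_eq_natDegree hg.ne_zero]
    norm_cast
    omega
  · have : Polynomial.aeval y g = 0 := hgy
    rw [map_add, map_mul, this, hh, mul_zero, zero_add]
  · rw [Polynomial.coeff_add, Polynomial.coeff_X_pow_mul', if_neg (by omega), zero_add]
  · rw [Polynomial.coeff_add, Polynomial.coeff_X_pow_mul', if_neg (by omega), zero_add]

/-! ### Comparison of the two local algebras -/

section Comparison

variable {A : Type*} [CommRing A] [IsLocalRing A] {n : ℕ} {F : Fin n → MvPolynomial (Fin n) A}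
  {f : Polynomial A} {y : QuotientRing F}

lemma aeval_coord_sub_mem (p : MvPolynomial (Fin n) A) :
    MvPolynomial.aeval (coord F) p - algebraMap A _ (MvPolynomial.eval 0 p) ∈ maxIdeal F := by
  induction p using MvPolynomial.induction_on with
  | C a => simp
  | add p q hp hq =>
    rw [map_add, map_add, map_add, add_sub_add_comm]
    exact Ideal.add_mem _ hp hq
  | mul_X p k _ =>
    have : coord F k ∈ maxIdeal F := mem_originIdeal ⟨k, rfl⟩
    simpa using Ideal.mul_mem_left _ _ this

/-- A surjective morphism `A_⟨f⟩ → B_{1 + M_B}` sending `x` to `y` is injective, since both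
algebras are étale over `A`: its kernel is finitely generated and idempotent. -/
lemma injective_of_surjective (hF : IsHenselSystem F) (hy : Polynomial.aeval y f = 0)
    (hfy : Polynomial.aeval y f.derivative ∈ onePlus (maxIdeal F))
    [IsLocalRing (LocalAlgebraOne f)] [IsLocalRing (LocalAlgebra F)]
    (φ : LocalAlgebraOne f →ₐ[A] LocalAlgebra F)
    (hφ : φ (algebraMap (AdjoinRoot f) _ (AdjoinRoot.root f)) = algebraMap (QuotientRing F) _ y)
    (hs : Function.Surjective φ) : Function.Injective φ := by
  classical
  have hmax := isMaximal_maxIdeal hF.eval_mem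
  have hloc : IsLocalHom (φ : LocalAlgebraOne f →+* LocalAlgebra F) := .of_surjective _ hs
  have hunit : ∀ d, IsUnit (φ d) → IsUnit d := fun d hd => hloc.map_nonunit d hd
  set J : Ideal (LocalAlgebraOne f) := RingHom.ker φ with hJ
  set ρ : LocalAlgebraOne f := algebraMap (AdjoinRoot f) _ (AdjoinRoot.root f) with hρ
  let x : Fin n → LocalAlgebra F := fun i => algebraMap (QuotientRing F) _ (coord F i)
  have hx : ∀ p : MvPolynomial (Fin n) A, MvPolynomial.aeval x p =
      algebraMap (QuotientRing F) _ (MvPolynomial.aeval (coord F) p) := fun p =>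
    MvPolynomial.aeval_algebraMap_apply _ _ _
  choose z hz using fun i => hs (x i)
  have hzφ : ∀ p : MvPolynomial (Fin n) A,
      φ (MvPolynomial.aeval z p) = MvPolynomial.aeval x p := by
    intro p
    rw [MvPolynomial.comp_aeval_apply, funext hz]
  have hFz : ∀ j, MvPolynomial.aeval z (F j) ∈ J := by
    intro j
    rw [RingHom.mem_ker, hzφ, hx, aeval_coord_apply, map_zero]
  let m : Matrix (Fin n) (Fin n) (LocalAlgebraOne f) :=
    Matrix.of fun i j => MvPolynomial.aeval z (MvPolynomial.pderiv i (F j))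
  have hdet : IsUnit m.det := by
    have : m.det = MvPolynomial.aeval z (jacobian F) := by
      rw [jacobian, AlgHom.map_det]
      rfl
    rw [this]
    apply hunit
    rw [hzφ, hx, isUnit_algebraMap_onePlus_iff]
    intro h
    have h1 := (maxIdeal F).sub_mem h (aeval_coord_sub_mem (jacobian F))
    rw [sub_sub_cancel] at h1
    exact hmax.ne_top (Ideal.eq_top_of_isUnit_mem _ h1 (hF.isUnit_jacobian.map _))
  -- Newton correction: it improves the lifted zero `z` modulo `J` to a zero modulo `J ^ 2`.
  let δ : Fin n → LocalAlgebraOne f := fun i => -∑ j, MvPolynomial.aeval z (F j) * m⁻¹ j i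
  have hδ : ∀ i, δ i ∈ J := fun i =>
    J.neg_mem (Ideal.sum_mem _ fun j _ => J.mul_mem_right _ (hFz j))
  have hδm : ∀ k, ∑ i, δ i * MvPolynomial.aeval z (MvPolynomial.pderiv i (F k)) =
      -MvPolynomial.aeval z (F k) := by
    intro k
    have : ∀ i, δ i * MvPolynomial.aeval z (MvPolynomial.pderiv i (F k)) =
        -∑ j, MvPolynomial.aeval z (F j) * (m⁻¹ j i * m i k) := by
      intro i
      simp only [δ, neg_mul, Finset.sum_mul, mul_assoc]
      rfl
    simp_rw [this, Finset.sum_neg_distrib]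
    rw [Finset.sum_comm]
    simp_rw [← Finset.mul_sum, ← Matrix.mul_apply, Matrix.nonsing_inv_mul m hdet, Matrix.one_apply]
    simp
  have hFδ : ∀ k, MvPolynomial.aeval (z + δ) (F k) ∈ J ^ 2 := by
    intro k
    have := aeval_add_sub_mem_sq J z δ hδ (F k)
    rwa [hδm, sub_neg_eq_add, sub_add_cancel] at this
  have hzδ : ∀ p : MvPolynomial (Fin n) A,
      φ (MvPolynomial.aeval (z + δ) p) = MvPolynomial.aeval x p := by
    intro p
    rw [MvPolynomial.comp_aeval_apply]
    congr 2
    ext i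
    have : φ (δ i) = 0 := hδ i
    simp [hz, this]
  obtain ⟨Y, rfl⟩ := Ideal.Quotient.mk_surjective y
  rw [← aeval_coord] at hy hfy hφ
  set w := MvPolynomial.aeval (z + δ) Y with hw
  have hφw : φ w = algebraMap (QuotientRing F) _ (MvPolynomial.aeval (coord F) Y) := by
    rw [hw, hzδ, hx]
  have hfw : Polynomial.aeval w f ∈ J ^ 2 := by
    have h1 : Polynomial.aeval Y f ∈ Ideal.span (Set.range F) := by
      rw [← Ideal.Quotient.eq_zero_iff_mem, ← aeval_coord, ← Polynomial.aeval_algHom_apply]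
      exact hy
    have h2 : Ideal.span (Set.range F) ≤ (J ^ 2).comap (MvPolynomial.aeval (z + δ)) := by
      rw [Ideal.span_le]
      rintro _ ⟨k, rfl⟩
      exact hFδ k
    have := h2 h1
    rwa [Ideal.mem_comap, ← Polynomial.aeval_algHom_apply] at this
  have hρw : ρ - w ∈ J := by
    rw [RingHom.mem_ker, map_sub, hφ, hφw, sub_self]
  -- Expand `f` at `w`: since `f(ρ) = 0`, `f(w) ∈ J ^ 2` and `f'(w)` is a unit, two roots congruent
  -- modulo `J` agree modulo `J ^ 2`.
  have hρw2 : ρ - w ∈ J ^ 2 := by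
    obtain ⟨k, hk⟩ := (f.map (algebraMap A (LocalAlgebraOne f))).binomExpansion w (ρ - w)
    rw [add_sub_cancel, Polynomial.derivative_map] at hk
    simp only [Polynomial.eval_map_algebraMap] at hk
    have hfρ : Polynomial.aeval ρ f = 0 := by
      rw [hρ, Polynomial.aeval_algebraMap_apply, AdjoinRoot.aeval_eq, AdjoinRoot.mk_self, map_zero]
    have hu : IsUnit (Polynomial.aeval w f.derivative) := by
      apply hunit
      rw [← Polynomial.aeval_algHom_apply, hφw, Polynomial.aeval_algebraMap_apply]
      exact IsLocalization.map_units _ (⟨_, hfy⟩ : onePlus (maxIdeal F))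
    rw [← Ideal.unit_mul_mem_iff_mem _ hu]
    have : Polynomial.aeval w f.derivative * (ρ - w) =
        -(Polynomial.aeval w f + k * (ρ - w) ^ 2) := by
      rw [hfρ] at hk
      linear_combination -hk
    rw [this]
    exact neg_mem (add_mem hfw (Ideal.mul_mem_left _ _ (Ideal.pow_mem_pow hρw 2)))
  let G : Set (LocalAlgebraOne f) :=
    insert (ρ - w) (Set.range fun k => MvPolynomial.aeval (z + δ) (F k))
  set K := Ideal.span G with hK
  have hKJ : K ≤ J ^ 2 := by
    rw [hK, Ideal.span_le]
    rintro _ (rfl | ⟨k, rfl⟩)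
    exacts [hρw2, hFδ k]
  let β : QuotientRing F →ₐ[A] LocalAlgebraOne f ⧸ K :=
    Ideal.Quotient.liftₐ (Ideal.span (Set.range F))
      ((Ideal.Quotient.mkₐ A K).comp (MvPolynomial.aeval (z + δ))) fun a ha => by
        have : Ideal.span (Set.range F) ≤ RingHom.ker
            ((Ideal.Quotient.mkₐ A K).comp (MvPolynomial.aeval (z + δ))) := by
          rw [Ideal.span_le]
          rintro _ ⟨k, rfl⟩
          change Ideal.Quotient.mk K _ = 0
          rw [Ideal.Quotient.eq_zero_iff_mem]
          exact Ideal.subset_span (Set.mem_insert_of_mem _ ⟨k, rfl⟩)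
        exact this ha
  have hβ : ∀ p : MvPolynomial (Fin n) A, β (MvPolynomial.aeval (coord F) p) =
      Ideal.Quotient.mk K (MvPolynomial.aeval (z + δ) p) := by
    intro p
    rw [aeval_coord]
    rfl
  -- Modulo `K` the corrected point is an exact zero, which defines a map back. Since `ρ ≡ w` modulo
  -- `K`, its composite with `φ` is the quotient map, forcing `J ≤ K`.
  let σ : LocalAlgebra F →ₐ[A] LocalAlgebraOne f ⧸ K :=
    IsLocalization.liftAlgHom (M := onePlus (maxIdeal F)) (f := β) fun s => by
      obtain ⟨S, hS⟩ := Ideal.Quotient.mk_surjective (s : QuotientRing F)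
      rw [← aeval_coord] at hS
      rw [← hS, hβ]
      refine IsUnit.map _ (hunit _ ?_)
      rw [hzδ, hx, hS]
      exact IsLocalization.map_units _ s
  have hσφ : σ.comp φ = Ideal.Quotient.mkₐ A K := by
    refine IsLocalization.algHom_ext (onePlus (originIdeal A {AdjoinRoot.root f})) ?_
    refine AdjoinRoot.algHom_ext ?_
    change σ (φ ρ) = Ideal.Quotient.mk K ρ
    rw [hφ]
    change IsLocalization.lift _ _ = _
    rw [IsLocalization.lift_eq]
    change β _ = _
    rw [hβ, eq_comm, Ideal.Quotient.eq]
    exact Ideal.subset_span (Set.mem_insert _ _)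
  have hJK : J ≤ K := by
    intro d hd
    rw [← Ideal.Quotient.eq_zero_iff_mem]
    have : σ (φ d) = Ideal.Quotient.mk K d := DFunLike.congr_fun hσφ d
    rw [← this, (show φ d = 0 from hd), map_zero]
  have hJJ : J = K := le_antisymm hJK (hKJ.trans (Ideal.pow_le_self two_ne_zero))
  have hJbot : J = ⊥ := by
    refine Submodule.eq_bot_of_le_smul_of_le_jacobson_bot J J ?_ ?_ ?_
    · rw [hJJ]
      exact Submodule.fg_span ((Set.finite_range _).insert _)
    · rw [smul_eq_mul, ← pow_two]
      exact hJK.trans hKJ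
    · rw [IsLocalRing.jacobson_eq_maximalIdeal ⊥ bot_ne_top]
      exact IsLocalRing.le_maximalIdeal (RingHom.ker_ne_top φ)
  exact (RingHom.injective_iff_ker_eq_bot (φ : LocalAlgebraOne f →+* LocalAlgebra F)).2 hJbot

lemma originIdeal_le_comap (hyI : y ∈ maxIdeal F) {R : Type*} [CommRing R] [Algebra A R] {x : R}
    (γ : R →ₐ[A] QuotientRing F) (hγ : γ x = y) :
    originIdeal A {x} ≤ (maxIdeal F).comap γ := by
  refine sup_le ?_ ?_
  · rw [Ideal.map_le_iff_le_comap]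
    intro a ha
    rw [Ideal.mem_comap, Ideal.mem_comap, AlgHom.commutes]
    exact algebraMap_mem_originIdeal _ ha
  · rw [Ideal.span_singleton_le_iff_mem, Ideal.mem_comap, hγ]
    exact hyI

lemma exists_algEquiv (hF : IsHenselSystem F) (hyI : y ∈ maxIdeal F)
    (hy : Polynomial.aeval y f = 0)
    (hfy : Polynomial.aeval y f.derivative ∈ onePlus (maxIdeal F))
    (hx : ∀ i, MemAdjoinLocalized F y (algebraMap (QuotientRing F) (LocalAlgebra F) (coord F i))) :
    ∃ e : LocalAlgebraOne f ≃ₐ[A] LocalAlgebra F,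
      e (algebraMap (AdjoinRoot f) (LocalAlgebraOne f) (AdjoinRoot.root f)) =
        algebraMap (QuotientRing F) (LocalAlgebra F) y := by
  have hmax := isMaximal_maxIdeal hF.eval_mem
  have hlocE : IsLocalRing (LocalAlgebra F) := isLocalRing_localization_onePlus (maxIdeal F)
  let γ : AdjoinRoot f →ₐ[A] QuotientRing F := AdjoinRoot.liftAlgHom f (Algebra.ofId _ _) y hy
  have hγ : γ (AdjoinRoot.root f) = y := AdjoinRoot.liftAlgHom_root _ _ _ _
  have hle := originIdeal_le_comap hyI γ hγ
  have hmaxD : (originIdeal A {AdjoinRoot.root f}).IsMaximal := by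
    refine isMaximal_originIdeal AdjoinRoot.adjoinRoot_eq_top fun h => ?_
    rw [h, top_le_iff, Ideal.comap_eq_top_iff] at hle
    exact hmax.ne_top hle
  have hlocD : IsLocalRing (LocalAlgebraOne f) := isLocalRing_localization_onePlus _
  have hone : ∀ s ∈ onePlus (originIdeal A {AdjoinRoot.root f}), γ s ∈ onePlus (maxIdeal F) := by
    intro s hs
    have := hle hs
    rwa [Ideal.mem_comap, map_sub, map_one] at this
  let φ : LocalAlgebraOne f →ₐ[A] LocalAlgebra F :=
    IsLocalization.liftAlgHom (M := onePlus (originIdeal A {AdjoinRoot.root f}))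
      (f := (IsScalarTower.toAlgHom A (QuotientRing F) (LocalAlgebra F)).comp γ) fun s =>
        IsLocalization.map_units _ (⟨γ s, hone s s.2⟩ : onePlus (maxIdeal F))
  have hφ : ∀ d, φ (algebraMap (AdjoinRoot f) _ d) = algebraMap (QuotientRing F) _ (γ d) :=
    fun d => IsLocalization.lift_eq _ d
  -- `φ` reflects units because `γ` sends the maximal ideal of the source into `M_B`. Denominators
  -- can thus be inverted before surjectivity is known.
  have hunit : ∀ d, IsUnit (φ d) → IsUnit d := by
    intro d hd
    obtain ⟨b, s, rfl⟩ := IsLocalization.exists_mk'_eq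
      (onePlus (originIdeal A {AdjoinRoot.root f})) d
    have hs := IsLocalization.map_units (LocalAlgebraOne f) s
    have h1 := IsLocalization.mk'_spec (LocalAlgebraOne f) b s
    have h2 : IsUnit (φ (algebraMap _ (LocalAlgebraOne f) b)) := by
      rw [← h1, map_mul]
      exact hd.mul (hs.map φ)
    rw [hφ, isUnit_algebraMap_onePlus_iff] at h2
    refine isUnit_of_mul_isUnit_left (y := algebraMap _ (LocalAlgebraOne f) (s : AdjoinRoot f)) ?_
    rw [h1, isUnit_algebraMap_onePlus_iff]
    exact fun h => h2 (hle h)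
  have hxr : ∀ i, algebraMap (QuotientRing F) (LocalAlgebra F) (coord F i) ∈ φ.range := by
    intro i
    obtain ⟨p, q, hq, hpq⟩ := hx i
    obtain ⟨P, hP⟩ := exists_aeval_eq p.2
    obtain ⟨Q, hQ⟩ := exists_aeval_eq q.2
    have hlift : ∀ P : Polynomial A, φ (algebraMap (AdjoinRoot f) _ (AdjoinRoot.mk f P)) =
        algebraMap (QuotientRing F) _ (Polynomial.aeval y P) := by
      intro P
      rw [hφ, ← AdjoinRoot.aeval_eq, ← Polynomial.aeval_algHom_apply, hγ]
    rw [← hP, ← hQ, ← hlift, ← hlift] at hpq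
    have hQu : IsUnit (algebraMap (AdjoinRoot f) (LocalAlgebraOne f) (AdjoinRoot.mk f Q)) := by
      apply hunit
      rw [hlift, hQ]
      have : (q : QuotientRing F) ∈ onePlus (maxIdeal F) :=
        coe_mem_of_mem_adjoinIdeal hyI hq
      exact IsLocalization.map_units _ (⟨_, this⟩ : onePlus (maxIdeal F))
    obtain ⟨v, hv⟩ := hQu.exists_right_inv
    refine ⟨algebraMap _ _ (AdjoinRoot.mk f P) * v, ?_⟩
    change φ _ = _
    rw [map_mul, ← hpq, mul_assoc, ← map_mul, hv, map_one, mul_one]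
  have hB : ∀ b, algebraMap (QuotientRing F) (LocalAlgebra F) b ∈ φ.range := by
    intro b
    have : (⊤ : Subalgebra A (QuotientRing F)) ≤
        φ.range.comap (IsScalarTower.toAlgHom A (QuotientRing F) (LocalAlgebra F)) := by
      rw [← adjoin_range_coord, Algebra.adjoin_le_iff]
      rintro _ ⟨i, rfl⟩
      exact hxr i
    exact this Algebra.mem_top
  have hsurj : Function.Surjective φ := by
    intro d
    obtain ⟨b, s, rfl⟩ := IsLocalization.exists_mk'_eq (onePlus (maxIdeal F)) d
    obtain ⟨u, hu⟩ : ∃ u, φ u = _ := hB b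
    obtain ⟨v, hv⟩ : ∃ v, φ v = _ := hB s
    have hs := IsLocalization.map_units (LocalAlgebra F) s
    obtain ⟨v', hv'⟩ := (hunit v (by rw [hv]; exact hs)).exists_right_inv
    refine ⟨u * v', hs.mul_right_cancel ?_⟩
    rw [IsLocalization.mk'_spec, ← hv, ← map_mul, mul_assoc, mul_comm v', hv', mul_one, hu]
  have hroot : φ (algebraMap (AdjoinRoot f) _ (AdjoinRoot.root f)) =
      algebraMap (QuotientRing F) _ y := by rw [hφ, hγ]
  exact ⟨AlgEquiv.ofBijective φ ⟨injective_of_surjective hF hy hfy φ hroot hsurj, hsurj⟩, hroot⟩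

end Comparison

end Hensel

theorem mainTheorem8 {A : Type*} [CommRing A] [IsLocalRing A] {n : ℕ}
    (F : Fin n → MvPolynomial (Fin n) A) (hF : Hensel.IsHenselSystem F) :
    IsLocalRing (Hensel.LocalAlgebra F) ∧
    ∃ y ∈ Hensel.maxIdeal F, ∃ f : Polynomial A,
      f.Monic ∧
      Polynomial.aeval y f = 0 ∧
      f.eval 0 ∈ IsLocalRing.maximalIdeal A ∧
      f.derivative.eval 0 ∈ Hensel.onePlus (IsLocalRing.maximalIdeal A) ∧
      Polynomial.aeval y f.derivative ∈ Hensel.onePlus (Hensel.maxIdeal F) ∧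
      (∀ i, Hensel.MemAdjoinLocalized F y
        (algebraMap (Hensel.QuotientRing F) (Hensel.LocalAlgebra F) (Hensel.coord F i))) ∧
      ∃ e : Hensel.LocalAlgebraOne f ≃ₐ[A] Hensel.LocalAlgebra F,
        e (algebraMap (AdjoinRoot f) (Hensel.LocalAlgebraOne f) (AdjoinRoot.root f)) =
          algebraMap (Hensel.QuotientRing F) (Hensel.LocalAlgebra F) y := by
  have hmax := Hensel.isMaximal_maxIdeal hF.eval_mem
  obtain ⟨t, ht, htI⟩ := Hensel.exists_onePlus_mul_mem_map hF
  obtain ⟨y, hyI, hyint, ⟨h, hhy, hh0, hh1⟩, hpq⟩ := Hensel.exists_adjoin_generator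
    (Set.finite_range _) (Hensel.adjoin_range_coord F) hmax.ne_top ht htI
  obtain ⟨f, hf, hfy, hf0, hf1⟩ := Hensel.exists_monic_aeval_eq_zero hyint hhy
  have hder : f.derivative.eval 0 ∈ Hensel.onePlus (IsLocalRing.maximalIdeal A) := by
    rw [← Polynomial.coeff_zero_eq_eval_zero, Polynomial.coeff_derivative]
    simpa [hf1] using hh1
  have hdery : Polynomial.aeval y f.derivative ∈ Hensel.onePlus (Hensel.maxIdeal F) := by
    obtain ⟨z, -, hz⟩ := Hensel.aeval_sub_eval_zero y f.derivative
    have h1 := Hensel.algebraMap_mem_originIdeal (Set.range (Hensel.coord F)) hder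
    rw [map_sub, map_one] at h1
    rw [Hensel.mem_onePlus, hz, add_sub_right_comm]
    exact Ideal.add_mem _ h1 (Ideal.mul_mem_right _ _ hyI)
  have hmem : ∀ i, Hensel.MemAdjoinLocalized F y
      (algebraMap (Hensel.QuotientRing F) (Hensel.LocalAlgebra F) (Hensel.coord F i)) := by
    intro i
    obtain ⟨p, q, hq, h⟩ := hpq _ ⟨i, rfl⟩
    exact ⟨p, q, hq, by rw [← map_mul, h]⟩
  refine ⟨Hensel.isLocalRing_localization_onePlus _, y, hyI, f, hf, hfy, ?_, hder, hdery, hmem,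
    Hensel.exists_algEquiv hF hyI hfy hdery hmem⟩
  rw [← Polynomial.coeff_zero_eq_eval_zero, hf0]
  exact hh0
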